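/- Let $V$ be a finite-dimensional real vector space with a positive semidefinite symmetric bilinear form $(\cdot,\cdot)$. For $R\subseteq V$ put $R^\times=\{\alpha\in R\mid(\alpha,\alpha)\neq0\}$, $R^0=\{\alpha\in R\mid(\alpha,\alpha)=0\}$, and let $\langle R\rangle$ be the $\mathbb Z$-span of $R$. Recall that $R$ is a (reduced) \emph{extended affine root system} in $V$ if: $0\in R$; $-R=R$; $R$ spans $V$; $2\alpha\notin R$ for $\alpha\in R^\times$; $R$ is discrete in $V$; for all $\alpha\in R^\times$, $\beta\in R$ there are $d,u\in\mathbb Z_{\ge0}$ with $\{n\in\mathbb Z\mid\beta+n\alpha\in R\}=\{-d,\dots,u\}$ and $d-u=2(\beta,\alpha)/(\alpha,\alpha)$; $R^\times$ is not the disjoint union of two non-empty mutually orthogonal subsets; and for every $\sigma\in R^0$ there is $\alpha\in R^\times$ with $\alpha+\sigma\in R$. For $\alpha\in R^\times$ let $w_\alpha(x)=x-\frac{2(\alpha,x)}{(\alpha,\alpha)}\alpha$; for $\mathcal P\subseteq R^\times$ let $\mathcal W_{\mathcal P}$ be the group generated by the $w_\alpha$, $\alpha\in\mathcal P$. A \emph{reflectable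 base} of $R$ is a subset $\mathcal P\subseteq R^\times$ with $\mathcal W_{\mathcal P}\mathcal P=R^\times$ such that no proper subset of $\mathcal P$ has this property. Let $\mathrm{refl}(R)$ be the smallest cardinality of a reflectable base, $V^0$ the real span of $R^0$, $\mathrm{null}(R)=\dim V^0$, $\mathrm{rank}(R)$ the rank of the finite root system that is the image of $R$ in $V/V^0$, and $\mathrm{ind}(R)=\mathrm{refl}(R)-\mathrm{rank}(R)-\mathrm{null}(R)$. A \emph{finite-order character} of $R$ is a map $\Phi:R\to\mathbb C^\times$ such that $\Phi(\alpha+\beta)=\Phi(\alpha)\Phi(\beta)$ whenever $\alpha,\beta,\alpha+\beta\in R$, and such that for some integer $m>0$ one has $\Phi(\alpha)^m=1$ for all $\alpha\in R$. \textbf{Lemma.} Let $R$ be an extended affine root system with $\mathrm{ind}(R)=0$ and let $\Phi:R\to\mathbb C^\times$ be a finite-order character. Then $\Phi$ extends to a group homomorphism $\widehat\Phi:\langle R\rangle\to\mathbb C^\times$ of finite order, i.e. there is an integer $m>0$ with $\widehat\Phi(x)^m=1$ for all $x\in\langle R\rangle$. -/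

import Mathlib

namespace ExtendedAffine

section Roots

variable {V : Type*} [AddCommGroup V] [Module ℝ V]

/-- The set `R^×` of non-isotropic elements of `R`. -/
def nonisotropic (B : LinearMap.BilinForm ℝ V) (R : Set V) : Set V := {α ∈ R | B α α ≠ 0}

/-- The set `R^0` of isotropic elements of `R`. -/
def isotropic (B : LinearMap.BilinForm ℝ V) (R : Set V) : Set V := {σ ∈ R | B σ σ = 0}

/-- `R` is a (reduced) extended affine root system in the finite dimensional real vector space `V`
with respect to the positive semidefinite symmetric bilinear form `B`. The topology on `V` is meant
to be the usual one, that is, the unique Hausdorff vector space topology.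
(`V ≠ 0` is automatic, by `zero_mem` and `nonisolated`.) -/
structure IsExtendedAffineRootSystem [TopologicalSpace V] (B : LinearMap.BilinForm ℝ V)
    (R : Set V) : Prop where
  finiteDimensional : FiniteDimensional ℝ V
  symm : ∀ x y, B x y = B y x
  nonneg : ∀ x, 0 ≤ B x x
  zero_mem : (0 : V) ∈ R
  neg_mem : ∀ α ∈ R, -α ∈ R
  span_eq_top : Submodule.span ℝ R = ⊤
  reduced : ∀ α ∈ nonisotropic B R, (2 : ℝ) • α ∉ R
  discrete : DiscreteTopology R
  /-- root strings are unbroken, with `d - u` the Cartan integer -/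
  root_string : ∀ α ∈ nonisotropic B R, ∀ β ∈ R, ∃ d u : ℕ,
    (∀ n : ℤ, β + n • α ∈ R ↔ -(d : ℤ) ≤ n ∧ n ≤ u) ∧ (d : ℝ) - u = 2 * B β α / B α α
  /-- `R^×` is not a disjoint union of two nonempty orthogonal subsets -/
  indecomposable : ∀ R₁ R₂ : Set V, R₁ ∪ R₂ = nonisotropic B R → Disjoint R₁ R₂ →
    R₁.Nonempty → R₂.Nonempty → ∃ α ∈ R₁, ∃ β ∈ R₂, B α β ≠ 0
  /-- isotropic roots are non-isolated -/
  nonisolated : ∀ σ ∈ isotropic B R, ∃ α ∈ nonisotropic B R, α + σ ∈ R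

/-- `w_α(x) = x - (2(α,x)/(α,α)) α`, as a linear map. It is only of interest if `(α,α) ≠ 0`. -/
noncomputable def reflectionMap (B : LinearMap.BilinForm ℝ V) (α : V) : V →ₗ[ℝ] V :=
  LinearMap.id - ((2 / B α α) • B α).smulRight α

theorem reflectionMap_apply (B : LinearMap.BilinForm ℝ V) (α x : V) :
    reflectionMap B α x = x - (2 * B α x / B α α) • α := by
  simp [reflectionMap, div_mul_eq_mul_div]

theorem reflectionMap_involutive (B : LinearMap.BilinForm ℝ V) (α : V) :
    Function.Involutive (reflectionMap B α) := by
  intro x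
  by_cases h : B α α = 0
  · simp [reflectionMap_apply, h]
  · have key : 2 * (B α x - 2 * B α x / B α α * B α α) / B α α = -(2 * B α x / B α α) := by
      field_simp
      ring
    rw [reflectionMap_apply, reflectionMap_apply, map_sub, map_smul, smul_eq_mul, key, neg_smul]
    abel

/-- The reflection `w_α`, as an element of `GL(V)`. -/
noncomputable def reflection (B : LinearMap.BilinForm ℝ V) (α : V) : V ≃ₗ[ℝ] V :=
  LinearEquiv.ofInvolutive (reflectionMap B α) (reflectionMap_involutive B α)

/-- `W_P`, the group generated by the reflections `w_α`, `α ∈ P` (in its action on `V`). -/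
def weylGroup (B : LinearMap.BilinForm ℝ V) (P : Set V) : Subgroup (V ≃ₗ[ℝ] V) :=
  Subgroup.closure (reflection B '' P)

/-- `W_P P`, the set of all `w(α)` with `w ∈ W_P` and `α ∈ P`. -/
def weylOrbit (B : LinearMap.BilinForm ℝ V) (P : Set V) : Set V :=
  {x | ∃ w ∈ weylGroup B P, ∃ α ∈ P, w α = x}

/-- `P` is a reflectable base for `R`: a subset of `R^×` with `W_P P = R^×`, no proper subset of
which has this property. -/
structure IsReflectableBase (B : LinearMap.BilinForm ℝ V) (R P : Set V) : Prop where
  subset : P ⊆ nonisotropic B R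
  orbit_eq : weylOrbit B P = nonisotropic B R
  minimal : ∀ Q, Q ⊂ P → weylOrbit B Q ≠ nonisotropic B R

/-- `refl(R)`, the smallest cardinality of a (finite) reflectable base for `R`. -/
noncomputable def reflNumber (B : LinearMap.BilinForm ℝ V) (R : Set V) : ℕ :=
  sInf {n | ∃ P : Finset V, IsReflectableBase B R (P : Set V) ∧ P.card = n}

/-- `V^0`, the real span of the isotropic roots. -/
def isotropicSpan (B : LinearMap.BilinForm ℝ V) (R : Set V) : Submodule ℝ V :=
  Submodule.span ℝ (isotropic B R)

/-- The nullity of `R`. -/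
noncomputable def nullity (B : LinearMap.BilinForm ℝ V) (R : Set V) : ℕ :=
  Module.finrank ℝ (isotropicSpan B R)

/-- The rank of `R`: the dimension of the real span, in `V / V^0`, of the finite root system
which is the image of `R` there. -/
noncomputable def rank (B : LinearMap.BilinForm ℝ V) (R : Set V) : ℕ :=
  Module.finrank ℝ (Submodule.span ℝ ((isotropicSpan B R).mkQ '' R))

/-- `ind(R) = refl(R) - rank(R) - null(R)`. -/
noncomputable def index (B : LinearMap.BilinForm ℝ V) (R : Set V) : ℤ :=
  (reflNumber B R : ℤ) - rank B R - nullity B R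

end Roots

section Characters

variable {V : Type*} [AddCommGroup V]

/-- `Φ : R → ℂ^×` is a character: `Φ(α + β) = Φ(α) Φ(β)` whenever `α`, `β`, `α + β` are in `R`. -/
def IsCharacter (R : Set V) (Φ : R → ℂˣ) : Prop :=
  ∀ α β γ : R, (γ : V) = α + β → Φ γ = Φ α * Φ β

/-- The root lattice `⟨R⟩`, the `ℤ`-span of `R`. -/
def rootLattice (R : Set V) : AddSubgroup V := AddSubgroup.closure R

end Characters

/-- A `ℂ^×`-valued map is of finite order if a fixed positive power of it is constantly one. -/
def IsFiniteOrder {X : Type*} (f : X → ℂˣ) : Prop := ∃ m : ℕ, 0 < m ∧ ∀ x, f x ^ m = 1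

end ExtendedAffine

namespace ExtendedAffine

section ReflectableBases

variable {V : Type*} [AddCommGroup V] [Module ℝ V]

/-! Rank plus nullity is `dim V`, so index zero yields a reflectable base `P` with `dim V` elements.
Its integer span contains `R`, so `P` spans `V` and is therefore a basis. Hence `Φ` restricted to
`P` extends freely to a homomorphism on the `ℤ`-span of `P`. That it agrees with `Φ` on all of `R`
follows from `subset_of_partially_closed`: the agreement set is symmetric, closed under sums lying
in `R`, and contains `P`. -/

theorem reflection_apply (B : LinearMap.BilinForm ℝ V) (α x : V) :
    reflection B α x = x - (2 * B α x / B α α) • α :=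
  reflectionMap_apply B α x

theorem reflection_reflection (B : LinearMap.BilinForm ℝ V) (α x : V) :
    reflection B α (reflection B α x) = x :=
  reflectionMap_involutive B α x

variable [TopologicalSpace V] {B : LinearMap.BilinForm ℝ V} {R : Set V}

namespace IsExtendedAffineRootSystem

/-- A symmetric subset of `R` that is closed under those sums which lie in `R` is stable under the
reflections in its non-isotropic elements. -/
theorem reflection_mem_of_partially_closed (hR : IsExtendedAffineRootSystem B R) {G : Set V}
    (hGR : G ⊆ R) (hneg : ∀ x ∈ G, -x ∈ G) (hadd : ∀ x ∈ G, ∀ y ∈ G, x + y ∈ R → x + y ∈ G)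
    {α β : V} (hα : α ∈ G) (hα0 : B α α ≠ 0) (hβ : β ∈ G) : reflection B α β ∈ G := by
  obtain ⟨d, u, hstr, hdu⟩ := hR.root_string α ⟨hGR hα, hα0⟩ β (hGR hβ)
  -- The string is unbroken, so walking from `β` in steps of `±α` never leaves `R`, and each step
  -- stays in `G`.
  have key : ∀ n : ℤ, -(d : ℤ) ≤ n → n ≤ u → β + n • α ∈ G := by
    intro n
    induction n with
    | zero => intro _ _; simpa using hβ
    | succ n ih =>
      intro h₁ h₂
      have e : β + ((n : ℤ) + 1) • α = (β + (n : ℤ) • α) + α := by rw [add_smul, one_smul, add_assoc]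
      have hmem := (hstr _).2 ⟨h₁, h₂⟩
      rw [e] at hmem ⊢
      exact hadd _ (ih (by omega) (by omega)) _ hα hmem
    | pred n ih =>
      intro h₁ h₂
      have e : β + (-(n : ℤ) - 1) • α = (β + (-(n : ℤ)) • α) + -α := by
        rw [sub_smul, one_smul, sub_eq_add_neg, add_assoc]
      have hmem := (hstr _).2 ⟨h₁, h₂⟩
      rw [e] at hmem ⊢
      exact hadd _ (ih (by omega) (by omega)) _ (hneg _ hα) hmem
  have e : reflection B α β = β + ((u : ℤ) - d) • α := by
    rw [reflection_apply, hR.symm α β, ← hdu, ← Int.cast_smul_eq_zsmul ℝ, sub_eq_add_neg,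
      ← neg_smul]
    push_cast
    rw [neg_sub]
  rw [e]
  exact key _ (by omega) (by omega)

/-- A symmetric subset of `R` that is closed under those sums which lie in `R` is all of `R`
as soon as it contains a set whose Weyl orbit is `R^×`. -/
theorem subset_of_partially_closed (hR : IsExtendedAffineRootSystem B R) {P : Set V}
    (hP : P ⊆ nonisotropic B R) (horb : weylOrbit B P = nonisotropic B R) {G : Set V}
    (hGR : G ⊆ R) (hneg : ∀ x ∈ G, -x ∈ G) (hadd : ∀ x ∈ G, ∀ y ∈ G, x + y ∈ R → x + y ∈ G)
    (hPG : P ⊆ G) : R ⊆ G := by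
  -- An equivalence, so that the induction passes to inverses.
  have hw : ∀ w ∈ weylGroup B P, ∀ x, x ∈ G ↔ w x ∈ G := by
    intro w hw
    induction hw using Subgroup.closure_induction with
    | mem w hw =>
      obtain ⟨α, hα, rfl⟩ := hw
      have h := fun x hx ↦
        hR.reflection_mem_of_partially_closed hGR hneg hadd (β := x) (hPG hα) (hP hα).2 hx
      exact fun x ↦ ⟨h x, fun hx ↦ by simpa only [reflection_reflection] using h _ hx⟩
    | one => exact fun x ↦ Iff.rfl
    | mul w w' _ _ ih ih' => exact fun x ↦ (ih' x).trans (ih (w' x))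
    | inv w _ ih =>
      intro x
      rw [ih (w⁻¹ x), ← LinearEquiv.mul_apply, mul_inv_cancel]
      rfl
  have hnoniso : nonisotropic B R ⊆ G := by
    rw [← horb]
    rintro _ ⟨w, hwP, α, hα, rfl⟩
    exact (hw w hwP α).1 (hPG hα)
  intro σ hσ
  by_cases h0 : B σ σ = 0
  · obtain ⟨α, hα, hασ⟩ := hR.nonisolated σ ⟨hσ, h0⟩
    have h0' : B (α + σ) (α + σ) ≠ 0 := by
      -- By Cauchy–Schwarz for a semidefinite form, an isotropic vector lies in the radical. Thus `α
      -- + σ` is non-isotropic, and `σ` is a difference of two non-isotropic roots.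
      have hσα : B σ α = 0 := by
        have h := LinearMap.BilinForm.apply_mul_apply_le_of_forall_zero_le B hR.nonneg σ α
        rw [h0, zero_mul, hR.symm α σ] at h
        exact mul_self_eq_zero.1 (le_antisymm h (mul_self_nonneg _))
      simpa [hσα, hR.symm α σ, h0] using hα.2
    have e : α + σ + -α = σ := by abel
    rw [← e]
    exact hadd _ (hnoniso ⟨hασ, h0'⟩) _ (hneg _ (hnoniso hα)) (by rwa [e])
  · exact hnoniso ⟨hσ, h0⟩

theorem subset_span_int (hR : IsExtendedAffineRootSystem B R) {P : Set V}
    (hP : P ⊆ nonisotropic B R) (horb : weylOrbit B P = nonisotropic B R) :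
    R ⊆ Submodule.span ℤ P := by
  have h := hR.subset_of_partially_closed hP horb (G := R ∩ Submodule.span ℤ P)
    Set.inter_subset_left
    (fun x hx ↦ ⟨hR.neg_mem x hx.1, NegMemClass.neg_mem hx.2⟩)
    (fun x hx y hy hxy ↦ ⟨hxy, add_mem hx.2 hy.2⟩)
    (fun x hx ↦ ⟨(hP hx).1, Submodule.subset_span hx⟩)
  exact h.trans Set.inter_subset_right

theorem rank_add_nullity (hR : IsExtendedAffineRootSystem B R) :
    rank B R + nullity B R = Module.finrank ℝ V := by
  have := hR.finiteDimensional
  rw [rank, nullity, Submodule.span_image, hR.span_eq_top, Submodule.map_top,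
    Submodule.range_mkQ, finrank_top]
  exact Submodule.finrank_quotient_add_finrank _

/-- If the index vanishes, some reflectable base is a basis of `V`. -/
theorem exists_linearIndependent_of_index_eq_zero (hR : IsExtendedAffineRootSystem B R)
    (hind : index B R = 0) : ∃ P : Set V, P ⊆ nonisotropic B R ∧
      weylOrbit B P = nonisotropic B R ∧ LinearIndependent ℝ ((↑) : P → V) := by
  have := hR.finiteDimensional
  have hrefl : reflNumber B R = Module.finrank ℝ V := by
    have := hR.rank_add_nullity
    unfold index at hind
    omega
  -- Positivity excludes the default `sInf ∅ = 0`, so the infimum is attained by an actual finite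
  -- base.
  have hpos : 0 < Module.finrank ℝ V := by
    obtain ⟨α, hα, -⟩ := hR.nonisolated 0 ⟨hR.zero_mem, by simp⟩
    have : Nontrivial V := ⟨α, 0, fun h ↦ hα.2 (by simp [h])⟩
    exact Module.finrank_pos
  have hne : {n | ∃ P : Finset V, IsReflectableBase B R (P : Set V) ∧ P.card = n}.Nonempty :=
    Nat.nonempty_of_pos_sInf (by rw [← hrefl] at hpos; exact hpos)
  obtain ⟨P, hP, hcard⟩ := Nat.sInf_mem hne
  refine ⟨P, hP.subset, hP.orbit_eq, ?_⟩
  have hspan : ⊤ ≤ Submodule.span ℝ (Set.range (Subtype.val : ↥(P : Set V) → V)) := by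
    rw [Subtype.range_coe, ← hR.span_eq_top, Submodule.span_le]
    exact (hR.subset_span_int hP.subset hP.orbit_eq).trans
      (Submodule.span_subset_span ℤ ℝ (P : Set V))
  refine linearIndependent_of_top_le_span_of_card_eq_finrank hspan ?_
  rw [← hrefl, reflNumber, ← hcard]
  simp

end IsExtendedAffineRootSystem

end ReflectableBases

section Characters

variable {V : Type*} [AddCommGroup V] {R : Set V} {Φ : R → ℂˣ}

theorem IsCharacter.map_zero (hΦ : IsCharacter R Φ) (h0 : (0 : V) ∈ R) : Φ ⟨0, h0⟩ = 1 :=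
  left_eq_mul.1 (hΦ ⟨0, h0⟩ ⟨0, h0⟩ ⟨0, h0⟩ (add_zero 0).symm)

theorem IsCharacter.map_neg (hΦ : IsCharacter R Φ) (h0 : (0 : V) ∈ R) {x : V} (hx : x ∈ R)
    (hx' : -x ∈ R) : Φ ⟨-x, hx'⟩ = (Φ ⟨x, hx⟩)⁻¹ := by
  refine eq_inv_of_mul_eq_one_right ?_
  rw [← hΦ ⟨x, hx⟩ ⟨-x, hx'⟩ ⟨0, h0⟩ (add_neg_cancel x).symm, hΦ.map_zero h0]

/-- An additive character of the root lattice that extends a map of finite order on `R` has finite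
order. -/
theorem isFiniteOrder_of_extends (hfin : IsFiniteOrder Φ) (Ψ : AddChar (rootLattice R) ℂˣ)
    (hΨ : ∀ (α : V) (hα : α ∈ R), Ψ ⟨α, AddSubgroup.subset_closure hα⟩ = Φ ⟨α, hα⟩) :
    IsFiniteOrder (Ψ : rootLattice R → ℂˣ) := by
  obtain ⟨m, hm, h⟩ := hfin
  refine ⟨m, hm, ?_⟩
  rintro ⟨x, hx⟩
  induction hx using AddSubgroup.closure_induction with
  | mem x hx => rw [hΨ x hx, h]
  | zero => exact (congrArg (· ^ m) Ψ.map_zero_eq_one).trans (one_pow m)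
  | add x y hx hy ihx ihy =>
    have e := Ψ.map_add_eq_mul ⟨x, hx⟩ ⟨y, hy⟩
    refine (congrArg (· ^ m) e).trans ?_
    simp only [mul_pow, ihx, ihy, one_mul]
  | neg x hx ih =>
    have e := Ψ.map_neg_eq_inv ⟨x, hx⟩
    refine (congrArg (· ^ m) e).trans ?_
    simp only [inv_pow, ih, inv_one]

end Characters

end ExtendedAffine

open ExtendedAffine in
theorem mainTheorem6 {V : Type*} [AddCommGroup V] [Module ℝ V]
    [TopologicalSpace V] [IsTopologicalAddGroup V] [ContinuousSMul ℝ V] [T2Space V]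
    (B : LinearMap.BilinForm ℝ V) (R : Set V)
    (hR : ExtendedAffine.IsExtendedAffineRootSystem B R)
    (hind : ExtendedAffine.index B R = 0)
    (Φ : R → ℂˣ) (hΦ : ExtendedAffine.IsCharacter R Φ) (hfin : ExtendedAffine.IsFiniteOrder Φ) :
    ∃ Ψ : AddChar (ExtendedAffine.rootLattice R) ℂˣ,
      (∀ (α : V) (hα : α ∈ R), Ψ ⟨α, AddSubgroup.subset_closure hα⟩ = Φ ⟨α, hα⟩) ∧
      ExtendedAffine.IsFiniteOrder (Ψ : ExtendedAffine.rootLattice R → ℂˣ) := by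
  obtain ⟨P, hP, horb, hli⟩ := hR.exists_linearIndependent_of_index_eq_zero hind
  -- `P` is a `ℤ`-basis of its integer span, so values on `P` may be prescribed freely.
  have hliZ : LinearIndependent ℤ ((↑) : P → V) := hli.restrict_scalars' ℤ
  let b := Module.Basis.span hliZ
  let f := b.constr ℤ (fun p : P ↦ Additive.ofMul (Φ ⟨p, (hP p.2).1⟩))
  have hle : rootLattice R ≤
      (Submodule.span ℤ (Set.range ((↑) : P → V))).toAddSubgroup := by
    rw [rootLattice, AddSubgroup.closure_le, Subtype.range_coe]
    exact hR.subset_span_int hP horb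
  let g : rootLattice R →+ Additive ℂˣ := f.toAddMonoidHom.comp (AddSubgroup.inclusion hle)
  have hg : ∀ (α : V) (hα : α ∈ R),
      g ⟨α, AddSubgroup.subset_closure hα⟩ = Additive.ofMul (Φ ⟨α, hα⟩) := by
    have hsub := hR.subset_of_partially_closed hP horb
      (G := {x | ∃ hx : x ∈ R,
        g ⟨x, AddSubgroup.subset_closure hx⟩ = Additive.ofMul (Φ ⟨x, hx⟩)})
      (fun x hx ↦ hx.1) ?_ ?_ ?_
    · exact fun α hα ↦ (hsub hα).2
    · rintro x ⟨hx, e⟩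
      refine ⟨hR.neg_mem x hx, ?_⟩
      rw [hΦ.map_neg hR.zero_mem hx, ofMul_inv, ← e, ← map_neg]
      rfl
    · rintro x ⟨hx, ex⟩ y ⟨hy, ey⟩ hxy
      refine ⟨hxy, ?_⟩
      rw [hΦ ⟨x, hx⟩ ⟨y, hy⟩ ⟨x + y, hxy⟩ rfl, ofMul_mul, ← ex, ← ey, ← map_add]
      rfl
    · intro x hx
      refine ⟨(hP hx).1, ?_⟩
      have e := b.constr_basis ℤ (fun p : P ↦ Additive.ofMul (Φ ⟨p, (hP p.2).1⟩)) ⟨x, hx⟩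
      rw [← e]
      refine congrArg f (Subtype.ext ?_)
      exact (congrArg Subtype.val (Module.Basis.span_apply hliZ ⟨x, hx⟩)).symm
  have hext : ∀ (α : V) (hα : α ∈ R),
      AddChar.toAddMonoidHomEquiv.symm g ⟨α, AddSubgroup.subset_closure hα⟩ = Φ ⟨α, hα⟩ :=
    fun α hα ↦ congrArg Additive.toMul (hg α hα)
  exact ⟨_, hext, isFiniteOrder_of_extends hfin _ hext⟩
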